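/- Lemma 4.7. For an $m\times n$ real matrix $A$ and $x,y\in\mathbb R^n$ let $|Ax|\in\mathbb R^m$ denote the entrywise absolute value of $Ax$, let $\|\cdot\|$ be the Euclidean norm and $\|\cdot\|_1$ the $\ell_1$-norm, and put $\phi_1(x,y):=\min\{\|x+y\|,\|x-y\|\}$. Let $A\in\mathbb R^{m\times n}$ be a random matrix whose entries are i.i.d. standard Gaussians $N(0,1)$. There are universal constants $C_0,C_1,C_2>0$ and $\varepsilon_0>0$ such that for all $\varepsilon\in(0,\varepsilon_0)$ and all $m,n$ with $m>C_0\,n\,\varepsilon^{-4}\log\frac1\varepsilon$, with probability at least $1-C_1\exp(-C_2\varepsilon^4m)$, $$\sqrt{\tfrac2\pi}\,(2-\sqrt2-\varepsilon)\,\phi_1(x,y)\;\le\;\frac1m\big\|\,|Ax|-|Ay|\,\big\|_1\;\le\;\sqrt{\tfrac2\pi}\,(1+\varepsilon)\,\phi_1(x,y)\qquad\text{for all }x,y\in\mathbb R^n.$$ Consequently, the 1-Absolute Growth Property holds with high probability for $m$ sufficiently large: there are universal constants $D_0,D_1,D_2>0$ and $0<\nu_1<\nu_2<2\nu_1$ such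 that, whenever $m>D_0n$, with probability at least $1-D_1\exp(-D_2m)$, $$\nu_1\,\phi_1(x,y)\le\frac1m\big\|\,|Ax|-|Ay|\,\big\|_1\le\nu_2\,\phi_1(x,y)\qquad\text{for all }x,y\in\mathbb R^n.$$ -/

import Mathlib

open MeasureTheory ProbabilityTheory

noncomputable section

/-- Gaussian assumption: the entries of the random `m × n` matrix `A` are independent, each
with the standard normal law `N(0, 1)`. -/
structure IsStdGaussianMatrix {Ω : Type*} [MeasurableSpace Ω] (P : Measure Ω) {m n : ℕ}
    (A : Ω → Matrix (Fin m) (Fin n) ℝ) : Prop where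
  law : ∀ i j, HasLaw (fun ω => A ω i j) (gaussianReal 0 1) P
  indep : iIndepFun (fun (q : Fin m × Fin n) ω => A ω q.1 q.2) P

/-- The `ℓ₁`-norm `‖ |Ax|^p - |Ay|^p ‖₁`, absolute values and powers being entrywise. -/
def absDiffL1 (p : ℕ) {m n : ℕ} (A : Matrix (Fin m) (Fin n) ℝ)
    (x y : EuclideanSpace ℝ (Fin n)) : ℝ :=
  ∑ i, |(|(A.mulVec x.ofLp) i| ^ p - |(A.mulVec y.ofLp) i| ^ p)|

/-- `φ₁(x, y) = min {‖x + y‖, ‖x - y‖}`, with Euclidean norms. -/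
def phiOne {n : ℕ} (x y : EuclideanSpace ℝ (Fin n)) : ℝ :=
  min ‖x + y‖ ‖x - y‖

/-- The `p`-Absolute Growth Property of the matrix `A`, for the growth function `φ` and
with the constants `μ₁`, `μ₂`. -/
structure AbsoluteGrowthProperty (p : ℕ) {m n : ℕ} (A : Matrix (Fin m) (Fin n) ℝ)
    (φ : EuclideanSpace ℝ (Fin n) → EuclideanSpace ℝ (Fin n) → ℝ) (μ₁ μ₂ : ℝ) : Prop where
  pos : 0 < μ₁
  lt : μ₁ < μ₂
  lt_two_mul : μ₂ < 2 * μ₁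
  nonneg : ∀ x y, 0 ≤ φ x y
  growth : ∀ x y, μ₁ * φ x y ≤ 1 / (m : ℝ) * absDiffL1 p A x y ∧
    1 / (m : ℝ) * absDiffL1 p A x y ≤ μ₂ * φ x y

end

/-! Put `S w = ‖Aw‖₁ / m`, `u = x + y`, `v = x - y`. Entrywise `||p| - |q|| = min |p + q| |p - q|`,
and `min |a| |b| = |a| + |b| - (|a + b| + |a - b|) / 2`, so the middle quantity equals `S u + S v -
(S (u + v) + S (u - v)) / 2`. Everything thus reduces to one event: `S w` is within a factor `1 ± η`
of `√(2/π) ‖w‖` for all `w` (`measureReal_bounds_ge`). It follows from sub-Gaussian concentration at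
a fixed unit vector, a union bound over a net of the sphere, and extension of seminorm bounds from
the net. On this event the upper bound holds because a minimum is at most either term. For the lower
bound, shrink the longer of `u`, `v` to the norm of the shorter; the parallelogram law then gives
`‖u + v‖ + ‖u - v‖ ≤ 2√2 ‖v‖`, whence `2 - √2` (`le_mean_sum_min`). -/

/-! ### Moments and sub-Gaussianity of `|g|` for a standard Gaussian `g`. -/

lemma integral_abs_gaussianReal : ∫ x, |x| ∂(gaussianReal 0 1) = √(2 / Real.pi) := by
  rw [integral_gaussianReal_eq_integral_smul one_ne_zero]
  have h : ∀ x : ℝ, gaussianPDFReal 0 1 x • |x|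
      = (√(2 * Real.pi))⁻¹ * (|x| * Real.exp (-(1 / 2) * |x| ^ 2)) := fun x => by
    rw [gaussianPDFReal_def, smul_eq_mul, sq_abs]
    simp only [NNReal.coe_one, mul_one, sub_zero]
    rw [show -x ^ 2 / 2 = -(1 / 2) * x ^ 2 by ring]
    ring
  simp_rw [h]
  rw [integral_const_mul,
    integral_comp_abs (f := fun y : ℝ => y * Real.exp (-(1 / 2) * y ^ 2))]
  have hI : ∫ x in Set.Ioi (0 : ℝ), x * Real.exp (-(1 / 2) * x ^ 2) = 1 := by
    have := integral_rpow_mul_exp_neg_mul_rpow (p := 2) (q := 1) (b := 1 / 2)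
      (by norm_num) (by norm_num) (by norm_num)
    norm_num at this
    simpa using this
  rw [hI, Real.sqrt_mul (by norm_num), Real.sqrt_div (by norm_num)]
  have h2 : √2 * √2 = (2 : ℝ) := Real.mul_self_sqrt (by norm_num)
  have : √2 ≠ 0 := by positivity
  have : √Real.pi ≠ 0 := by positivity
  field_simp
  linarith

lemma integrable_exp_mul_abs_gaussianReal (t : ℝ) :
    Integrable (fun x => Real.exp (t * |x|)) (gaussianReal 0 1) := by
  refine Integrable.mono' ((integrable_exp_mul_gaussianReal (μ := 0) (v := 1) t).add
    (integrable_exp_mul_gaussianReal (μ := 0) (v := 1) (-t))) (by fun_prop)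
    (Filter.Eventually.of_forall fun x => ?_)
  rw [Real.norm_eq_abs, Real.abs_exp, Pi.add_apply]
  rcases abs_cases x with ⟨h, -⟩ | ⟨h, -⟩ <;> rw [h]
  · linarith [Real.exp_pos (-t * x)]
  · rw [mul_neg, ← neg_mul]
    linarith [Real.exp_pos (t * x)]

lemma integrable_abs_gaussianReal : Integrable (fun x : ℝ => |x|) (gaussianReal 0 1) := by
  refine Integrable.mono' (integrable_exp_mul_abs_gaussianReal 1) (by fun_prop)
    (Filter.Eventually.of_forall fun x => ?_)
  rw [Real.norm_eq_abs, abs_abs, one_mul]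
  linarith [Real.add_one_le_exp |x|]

/-- The integrand is even in `t`, so `|x|` may be replaced by `x`. -/
lemma integral_exp_abs_add_exp_neg_abs (t : ℝ) :
    ∫ x, Real.exp (t * |x|) ∂(gaussianReal 0 1) + ∫ x, Real.exp (-t * |x|) ∂(gaussianReal 0 1)
      = 2 * Real.exp (t ^ 2 / 2) := by
  have hm (s : ℝ) : ∫ x, Real.exp (s * x) ∂(gaussianReal 0 1) = Real.exp (s ^ 2 / 2) := by
    have := congrFun (mgf_fun_id_gaussianReal (μ := 0) (v := 1)) s
    simpa [mgf] using this
  rw [← integral_add (integrable_exp_mul_abs_gaussianReal t)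
    (integrable_exp_mul_abs_gaussianReal (-t))]
  have h : ∀ x : ℝ, Real.exp (t * |x|) + Real.exp (-t * |x|)
      = Real.exp (t * x) + Real.exp (-t * x) := fun x => by
    rcases abs_cases x with ⟨h, -⟩ | ⟨h, -⟩ <;> rw [h]
    rw [mul_neg, neg_mul_neg, neg_mul, add_comm]
  simp_rw [h]
  rw [integral_add (integrable_exp_mul_gaussianReal t) (integrable_exp_mul_gaussianReal (-t)),
    hm, hm, neg_sq]
  ring

/-- Jensen's inequality, by integrating the tangent line of `exp` at `t` times the mean. -/
lemma exp_mul_mean_le_integral_exp_abs (t : ℝ) :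
    Real.exp (t * √(2 / Real.pi)) ≤ ∫ x, Real.exp (t * |x|) ∂(gaussianReal 0 1) := by
  set a := √(2 / Real.pi) with ha
  have hi : Integrable (fun x : ℝ => |x| - a) (gaussianReal 0 1) :=
    integrable_abs_gaussianReal.sub (integrable_const _)
  have h : ∫ x, Real.exp (t * a) * (1 + t * (|x| - a)) ∂(gaussianReal 0 1)
      = Real.exp (t * a) := by
    rw [integral_const_mul, integral_add (integrable_const _) (hi.const_mul t), integral_const_mul,
      integral_sub integrable_abs_gaussianReal (integrable_const _), integral_abs_gaussianReal]
    simp [ha]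
  rw [← h]
  refine integral_mono (((integrable_const 1).add (hi.const_mul t)).const_mul _)
    (integrable_exp_mul_abs_gaussianReal t) fun x => ?_
  have := Real.add_one_le_exp (t * (|x| - a))
  calc Real.exp (t * a) * (1 + t * (|x| - a)) ≤ Real.exp (t * a) * Real.exp (t * (|x| - a)) := by
        gcongr; linarith
    _ = Real.exp (t * |x|) := by rw [← Real.exp_add]; ring_nf

/-- The centred absolute value of a standard Gaussian is sub-Gaussian with parameter `2`. -/
lemma hasSubgaussianMGF_abs_gaussianReal :
    HasSubgaussianMGF (fun x : ℝ => |x| - √(2 / Real.pi)) 2 (gaussianReal 0 1) where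
  integrable_exp_mul t := by
    have := (integrable_exp_mul_abs_gaussianReal t).mul_const (Real.exp (-(t * √(2 / Real.pi))))
    simpa only [← Real.exp_add, ← sub_eq_add_neg, ← mul_sub] using this
  mgf_le t := by
    have h1 : mgf (fun x : ℝ => |x| - √(2 / Real.pi)) (gaussianReal 0 1) t
        = Real.exp (-t * √(2 / Real.pi)) * ∫ x, Real.exp (t * |x|) ∂(gaussianReal 0 1) := by
      rw [mgf, ← integral_const_mul]
      congr 1 with x
      rw [← Real.exp_add]; ring_nf
    have h2 := exp_mul_mean_le_integral_exp_abs (-t)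
    have h3 := integral_exp_abs_add_exp_neg_abs t
    have h4 : 0 ≤ ∫ x, Real.exp (t * |x|) ∂(gaussianReal 0 1) :=
      integral_nonneg fun x => (Real.exp_pos _).le
    rw [h1]
    set a := ∫ x, Real.exp (t * |x|) ∂(gaussianReal 0 1)
    set b := ∫ x, Real.exp (-t * |x|) ∂(gaussianReal 0 1)
    -- Jensen at `-t` bounds the centring factor by `b`; AM-GM then needs only the sum `a + b`,
    -- which is explicit.
    calc _ ≤ b * a := by gcongr
      _ ≤ ((a + b) / 2) ^ 2 := by nlinarith [sq_nonneg (a - b)]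
      _ = Real.exp (t ^ 2 / 2) ^ 2 := by rw [h3]; ring
      _ = Real.exp (((2 : NNReal) : ℝ) * t ^ 2 / 2) := by
        rw [← Real.exp_nat_mul]; norm_num; ring_nf

/-! ### Law, independence and concentration of the coordinates of `Aw`. -/

section LinearCombination

variable {Ω : Type*} [MeasurableSpace Ω] {P : Measure Ω}

lemma charFun_map_sum_mul_gaussian {ι : Type*} [Fintype ι] {X : ι → Ω → ℝ}
    (hX : ∀ i, HasLaw (X i) (gaussianReal 0 1) P) (hI : iIndepFun X P) (c : ι → ℝ) (s : ℝ) :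
    charFun (P.map (fun ω => ∑ i, c i * X i ω)) s
      = Complex.exp (-(((∑ i, c i ^ 2) * s ^ 2 / 2 : ℝ) : ℂ)) := by
  have hI' : iIndepFun (fun i ω => c i * X i ω) P :=
    hI.comp (fun i x => c i * x) (fun i => by fun_prop)
  rw [hI'.charFun_map_fun_sum_eq_prod (fun i => (hX i).aemeasurable.const_mul (c i)),
    Finset.prod_apply]
  simp_rw [(gaussianReal_const_mul (hX _) (c _)).map_eq, charFun_gaussianReal]
  rw [← Complex.exp_sum]
  congr 1
  push_cast
  rw [Finset.sum_mul, Finset.sum_div, ← Finset.sum_neg_distrib]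
  refine Finset.sum_congr rfl fun i _ => ?_
  simp

variable [IsProbabilityMeasure P]

lemma hasLaw_sum_mul_gaussian {ι : Type*} [Fintype ι] {X : ι → Ω → ℝ}
    (hX : ∀ i, HasLaw (X i) (gaussianReal 0 1) P) (hI : iIndepFun X P) {c : ι → ℝ}
    (hc : ∑ i, c i ^ 2 = 1) :
    HasLaw (fun ω => ∑ i, c i * X i ω) (gaussianReal 0 1) P where
  aemeasurable := Finset.aemeasurable_fun_sum _ fun i _ => (hX i).aemeasurable.const_mul (c i)
  map_eq := by
    refine Measure.ext_of_charFun (funext fun s => ?_)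
    rw [charFun_map_sum_mul_gaussian hX hI, charFun_gaussianReal, hc]
    simp

variable {m n : ℕ} {A : Ω → Matrix (Fin m) (Fin n) ℝ}

lemma IsStdGaussianMatrix.hasLaw_mulVec (hA : IsStdGaussianMatrix P A)
    {w : EuclideanSpace ℝ (Fin n)} (hw : ‖w‖ = 1) (i : Fin m) :
    HasLaw (fun ω => (A ω).mulVec w.ofLp i) (gaussianReal 0 1) P := by
  have hI : iIndepFun (fun j ω => A ω i j) P :=
    hA.indep.precomp (g := fun j : Fin n => (i, j)) fun a b h => (Prod.mk.inj h).2
  have hc : ∑ j, w j ^ 2 = 1 := by rw [← EuclideanSpace.real_norm_sq_eq, hw, one_pow]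
  have := hasLaw_sum_mul_gaussian (fun j => hA.law i j) hI hc
  simpa only [Matrix.mulVec, dotProduct, mul_comm] using this

/-- `⟨Aw, t⟩` is a combination of all entries with coefficients `t i * w j`, whose squares sum to
`‖t‖²`; hence the joint characteristic function factorises. -/
lemma IsStdGaussianMatrix.iIndepFun_mulVec (hA : IsStdGaussianMatrix P A)
    {w : EuclideanSpace ℝ (Fin n)} (hw : ‖w‖ = 1) :
    iIndepFun (fun (i : Fin m) ω => (A ω).mulVec w.ofLp i) P := by
  have hL := hA.hasLaw_mulVec hw
  have hc : ∑ j, w j ^ 2 = 1 := by rw [← EuclideanSpace.real_norm_sq_eq, hw, one_pow]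
  rw [iIndepFun_iff_charFun_pi fun i => (hL i).aemeasurable]
  intro t
  have hmeas : AEMeasurable (fun ω => WithLp.toLp 2 fun i => (A ω).mulVec w.ofLp i) P :=
    (WithLp.measurable_toLp 2 _).comp_aemeasurable (aemeasurable_pi_lambda _ fun i =>
      (hL i).aemeasurable)
  have key := charFun_map_sum_mul_gaussian (fun q : Fin m × Fin n => hA.law q.1 q.2) hA.indep
    (fun q => t q.1 * w q.2) 1
  rw [charFun_apply_real, integral_map (Finset.aemeasurable_fun_sum _ fun q _ =>
    (hA.law q.1 q.2).aemeasurable.const_mul _) (by fun_prop)] at key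
  rw [charFun_apply, integral_map hmeas (by fun_prop)]
  have h1 : ∀ ω, inner ℝ (WithLp.toLp 2 fun i => (A ω).mulVec w.ofLp i) t
      = ∑ q : Fin m × Fin n, t q.1 * w q.2 * A ω q.1 q.2 := fun ω => by
    rw [Fintype.sum_prod_type]
    simp only [PiLp.inner_apply, Matrix.mulVec, dotProduct, RCLike.inner_apply, conj_trivial,
      Finset.mul_sum]
    exact Finset.sum_congr rfl fun i _ => Finset.sum_congr rfl fun j _ => by ring
  simp_rw [h1]
  simp only [Complex.ofReal_one, one_mul] at key
  rw [key]
  simp_rw [(hL _).map_eq, charFun_gaussianReal]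
  rw [← Complex.exp_sum]
  congr 1
  have h2 : ∑ q : Fin m × Fin n, (t q.1 * w q.2) ^ 2 = ∑ i, t i ^ 2 := by
    rw [Fintype.sum_prod_type]
    simp_rw [mul_pow, ← Finset.mul_sum, hc, mul_one]
  rw [h2]
  push_cast
  simp [Finset.sum_div]

/-- Concentration of `‖Aw‖₁` around `m √(2/π)` for a fixed unit vector `w`. -/
lemma IsStdGaussianMatrix.measureReal_abs_sum_sub_ge (hA : IsStdGaussianMatrix P A)
    {w : EuclideanSpace ℝ (Fin n)} (hw : ‖w‖ = 1) {s : ℝ} (hs : 0 ≤ s) :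
    P.real {ω | m * s ≤ |∑ i, |(A ω).mulVec w.ofLp i| - m * √(2 / Real.pi)|}
      ≤ 2 * Real.exp (-(m * s ^ 2 / 4)) := by
  have hL := hA.hasLaw_mulVec hw
  have hI : iIndepFun (fun (i : Fin m) ω => |(A ω).mulVec w.ofLp i| - √(2 / Real.pi)) P :=
    (hA.iIndepFun_mulVec hw).comp (fun _ x => |x| - √(2 / Real.pi)) (fun _ => by fun_prop)
  have hS : ∀ i ∈ Finset.univ, HasSubgaussianMGF
      (fun ω => |(A ω).mulVec w.ofLp i| - √(2 / Real.pi)) 2 P := fun i _ => by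
    have := hasSubgaussianMGF_abs_gaussianReal
    rw [← (hL i).map_eq] at this
    exact this.of_map (hL i).aemeasurable
  have hsum := HasSubgaussianMGF.sum_of_iIndepFun hI hS
  have hms : 0 ≤ m * s := by positivity
  have hE : Real.exp (-(m * s) ^ 2 / (2 * ((∑ _i : Fin m, (2 : NNReal) : NNReal) : ℝ)))
      = Real.exp (-(m * s ^ 2 / 4)) := by
    congr 1
    simp only [Finset.sum_const, Finset.card_univ, Fintype.card_fin, nsmul_eq_mul, NNReal.coe_mul,
      NNReal.coe_natCast, NNReal.coe_ofNat]
    rcases Nat.eq_zero_or_pos m with rfl | h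
    · simp
    · field_simp; ring
  have h1 := hsum.measure_ge_le hms
  have h2 := hsum.neg.measure_ge_le hms
  rw [hE] at h1 h2
  calc _ ≤ P.real ({ω | m * s ≤ ∑ i, (|(A ω).mulVec w.ofLp i| - √(2 / Real.pi))} ∪
        {ω | m * s ≤ (-fun ω => ∑ i, (|(A ω).mulVec w.ofLp i| - √(2 / Real.pi))) ω}) := by
        refine measureReal_mono fun ω hω => ?_
        simp only [Set.mem_ofPred_eq, Set.mem_union, Pi.neg_apply, Finset.sum_sub_distrib,
          Finset.sum_const, Finset.card_univ, Fintype.card_fin, nsmul_eq_mul] at hω ⊢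
        exact le_abs.mp hω
    _ ≤ _ := measureReal_union_le _ _
    _ ≤ _ := by linarith

end LinearCombination

/-! ### Nets of the unit sphere by volume comparison. -/

section Net

variable {E : Type*} [NormedAddCommGroup E] [NormedSpace ℝ E] [FiniteDimensional ℝ E]

/-- A `δ`-separated subset of the unit ball has at most `(1 + 2/δ)^dim` elements. -/
lemma card_le_of_separated_unitBall {δ : ℝ} (hδ : 0 < δ) (s : Finset E) (hs : ∀ c ∈ s, ‖c‖ ≤ 1)
    (h : ∀ c ∈ s, ∀ d ∈ s, c ≠ d → δ ≤ ‖c - d‖) :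
    (s.card : ℝ) ≤ (1 + 2 / δ) ^ Module.finrank ℝ E := by
  borelize E
  let μ : Measure E := Measure.addHaar
  have hδ2 : 0 < δ / 2 := by positivity
  have hρ : 0 < 1 + δ / 2 := by positivity
  have D : Set.Pairwise (s : Set E) (Function.onFun Disjoint fun c => Metric.ball c (δ / 2)) := by
    rintro c hc d hd hcd
    apply Metric.ball_disjoint_ball
    rw [dist_eq_norm, add_halves]
    exact h c hc d hd hcd
  have hsub : (⋃ c ∈ s, Metric.ball c (δ / 2)) ⊆ Metric.ball (0 : E) (1 + δ / 2) := by
    refine Set.iUnion₂_subset fun x hx => Metric.ball_subset_ball' ?_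
    rw [dist_zero_right]
    linarith [hs x hx]
  have I : (s.card : ENNReal) * ENNReal.ofReal ((δ / 2) ^ Module.finrank ℝ E) * μ (Metric.ball 0 1)
      ≤ ENNReal.ofReal ((1 + δ / 2) ^ Module.finrank ℝ E) * μ (Metric.ball 0 1) :=
    calc _ = μ (⋃ c ∈ s, Metric.ball c (δ / 2)) := by
          rw [measure_biUnion_finset D fun c _ => measurableSet_ball]
          simp only [μ.addHaar_ball_of_pos _ hδ2, Finset.sum_const, nsmul_eq_mul, mul_assoc]
      _ ≤ μ (Metric.ball (0 : E) (1 + δ / 2)) := measure_mono hsub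
      _ = _ := by simp only [μ.addHaar_ball_of_pos _ hρ]
  have J := (ENNReal.mul_le_mul_iff_left (Metric.measure_ball_pos _ _ zero_lt_one).ne'
    measure_ball_lt_top.ne).1 I
  have K := ENNReal.toReal_le_of_le_ofReal (pow_nonneg hρ.le _) J
  rw [ENNReal.toReal_mul, ENNReal.toReal_natCast, ENNReal.toReal_ofReal (by positivity)] at K
  rw [show 1 + 2 / δ = (1 + δ / 2) / (δ / 2) by field_simp; ring, div_pow, le_div_iff₀ (by positivity)]
  exact K

lemma exists_finset_net_sphere {δ : ℝ} (hδ : 0 < δ) (hδ1 : δ ≤ 1) :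
    ∃ T : Finset E, (∀ z ∈ T, ‖z‖ = 1) ∧ (∀ w : E, ‖w‖ = 1 → ∃ z ∈ T, ‖w - z‖ ≤ δ) ∧
      (T.card : ℝ) ≤ (3 / δ) ^ Module.finrank ℝ E := by
  classical
  let Sep (T : Finset E) : Prop := (∀ z ∈ T, ‖z‖ = 1) ∧ ∀ c ∈ T, ∀ d ∈ T, c ≠ d → δ ≤ ‖c - d‖
  have hcard : ∀ T, Sep T → (T.card : ℝ) ≤ (1 + 2 / δ) ^ Module.finrank ℝ E := fun T hT =>
    card_le_of_separated_unitBall hδ T (fun c hc => (hT.1 c hc).le) hT.2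
  let p (k : ℕ) : Prop := ∃ T, Sep T ∧ T.card = k
  have h0 : p 0 := ⟨∅, by simp [Sep], rfl⟩
  -- A separated set of greatest cardinality is a net: a point far from it could be added.
  obtain ⟨T, hT, hTcard⟩ := Nat.findGreatest_spec (P := p)
    (Nat.zero_le ⌊(1 + 2 / δ) ^ Module.finrank ℝ E⌋₊) h0
  refine ⟨T, hT.1, fun w hw => ?_, (hcard T hT).trans ?_⟩
  · by_contra! hfar
    have hwT : w ∉ T := fun h => by
      have := hfar w h
      rw [sub_self, norm_zero] at this
      linarith
    have hins : Sep (insert w T) := by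
      refine ⟨fun z hz => ?_, fun c hc d hd hcd => ?_⟩
      · rcases Finset.mem_insert.mp hz with rfl | h
        exacts [hw, hT.1 z h]
      · rcases Finset.mem_insert.mp hc with rfl | hcT <;>
          rcases Finset.mem_insert.mp hd with rfl | hdT
        · exact absurd rfl hcd
        · exact (hfar d hdT).le
        · rw [norm_sub_rev]
          exact (hfar c hcT).le
        · exact hT.2 c hcT d hdT hcd
    have hle := Nat.le_findGreatest (P := p) (Nat.le_floor (hcard _ hins)) ⟨_, hins, rfl⟩
    rw [Finset.card_insert_of_notMem hwT] at hle
    omega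
  · gcongr
    rw [le_div_iff₀ hδ, add_mul, div_mul_cancel₀ _ hδ.ne']
    linarith

end Net

/-! ### From a net to the whole space. -/

section Extension

variable {E : Type*} [NormedAddCommGroup E] [NormedSpace ℝ E] [FiniteDimensional ℝ E]

/-- Bounds on a seminorm over a net of the unit sphere extend to the whole space. -/
lemma Seminorm.bounds_of_net (S : Seminorm ℝ E) (hS : Continuous S) {δ μ : ℝ} (hδ : 0 < δ)
    (hδ2 : δ ≤ 1 / 2) (hμ : 0 < μ) {T : Finset E}
    (hnet : ∀ w : E, ‖w‖ = 1 → ∃ z ∈ T, ‖w - z‖ ≤ δ) (hz : ∀ z ∈ T, |S z - μ| ≤ δ * μ) (w : E) :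
    (1 - 4 * δ) * μ * ‖w‖ ≤ S w ∧ S w ≤ (1 + 4 * δ) * μ * ‖w‖ := by
  rcases eq_or_ne w 0 with rfl | hw
  · simp
  have hscale : ∀ x : E, S x = ‖x‖ * S (‖x‖⁻¹ • x) := fun x => by
    rcases eq_or_ne x 0 with rfl | hx
    · simp
    · rw [map_smul_eq_mul, norm_inv, norm_norm, ← mul_assoc,
        mul_inv_cancel₀ (norm_ne_zero_iff.mpr hx), one_mul]
  have hunit : ∀ x : E, x ≠ 0 → ‖‖x‖⁻¹ • x‖ = 1 := fun x hx => by
    rw [norm_smul, norm_inv, norm_norm, inv_mul_cancel₀ (norm_ne_zero_iff.mpr hx)]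
  obtain ⟨x₀, hx₀, hmax⟩ := (isCompact_sphere (0 : E) 1).exists_isMaxOn
    ⟨‖w‖⁻¹ • w, by simpa using hunit w hw⟩ hS.continuousOn
  have hle : ∀ x : E, S x ≤ ‖x‖ * S x₀ := fun x => by
    rcases eq_or_ne x 0 with rfl | hx
    · simp
    · rw [hscale x]
      exact mul_le_mul_of_nonneg_left (hmax (by simpa using hunit x hx)) (norm_nonneg x)
  have hupper : S x₀ ≤ (1 + 4 * δ) * μ := by
    obtain ⟨z, hzT, hdist⟩ := hnet x₀ (by simpa using hx₀)
    have h1 : S x₀ ≤ S z + S (x₀ - z) := by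
      simpa using map_add_le_add S z (x₀ - z)
    have h2 := (abs_le.mp (hz z hzT)).2
    have h3 : S (x₀ - z) ≤ δ * S x₀ :=
      (hle _).trans (mul_le_mul_of_nonneg_right hdist (apply_nonneg S _))
    -- From `S x₀ ≤ (1 + δ) μ + δ S x₀`; the constant 4 works because `1 + δ ≤ (1 - δ)(1 + 4δ)` when
    -- `δ ≤ 1/2`.
    have h4 : (1 - δ) * S x₀ ≤ (1 - δ) * ((1 + 4 * δ) * μ) := by
      have : 0 ≤ (2 * δ - 4 * δ ^ 2) * μ := mul_nonneg (by nlinarith) hμ.le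
      nlinarith
    exact le_of_mul_le_mul_left h4 (by linarith)
  have hlower : (1 - 4 * δ) * μ ≤ S (‖w‖⁻¹ • w) := by
    obtain ⟨z, hzT, hdist⟩ := hnet _ (hunit w hw)
    set x := ‖w‖⁻¹ • w
    have h1 : S z ≤ S x + S (x - z) := by
      have := map_add_le_add S x (-(x - z))
      rwa [map_neg_eq_map, ← sub_eq_add_neg, sub_sub_cancel] at this
    have h2 := (abs_le.mp (hz z hzT)).1
    have h3 : S (x - z) ≤ δ * ((1 + 4 * δ) * μ) :=
      (hle _).trans (mul_le_mul hdist hupper (apply_nonneg S _) hδ.le)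
    have : 0 ≤ (2 * δ - 4 * δ ^ 2) * μ := mul_nonneg (by nlinarith) hμ.le
    nlinarith
  have hwpos : 0 < ‖w‖ := norm_pos_iff.mpr hw
  refine ⟨?_, (hle w).trans (by rw [mul_comm]; gcongr)⟩
  rw [hscale w, mul_comm]
  gcongr

end Extension

/-! ### Deterministic growth bounds from the `ℓ₁`-isometry property. -/

section MeanAbs

variable {m n : ℕ}

/-- The seminorm `w ↦ (1/m) ‖Aw‖₁`. -/
noncomputable def meanAbsMulVec (A : Matrix (Fin m) (Fin n) ℝ) :
    Seminorm ℝ (EuclideanSpace ℝ (Fin n)) :=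
  Seminorm.of (fun w => 1 / (m : ℝ) * ∑ i, |A.mulVec w.ofLp i|)
    (fun x y => by
      rw [← mul_add, ← Finset.sum_add_distrib]
      gcongr with i
      rw [WithLp.ofLp_add, Matrix.mulVec_add, Pi.add_apply]
      exact abs_add_le _ _)
    (fun a x => by
      simp only [WithLp.ofLp_smul, Matrix.mulVec_smul, Pi.smul_apply, smul_eq_mul, abs_mul,
        ← Finset.mul_sum, Real.norm_eq_abs]
      ring)

lemma meanAbsMulVec_apply (A : Matrix (Fin m) (Fin n) ℝ) (w : EuclideanSpace ℝ (Fin n)) :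
    meanAbsMulVec A w = 1 / (m : ℝ) * ∑ i, |A.mulVec w.ofLp i| := rfl

lemma continuous_meanAbsMulVec (A : Matrix (Fin m) (Fin n) ℝ) :
    Continuous (meanAbsMulVec A) := by
  change Continuous fun w : EuclideanSpace ℝ (Fin n) => 1 / (m : ℝ) * ∑ i, |A.mulVec w.ofLp i|
  simp only [Matrix.mulVec, dotProduct]
  fun_prop

lemma abs_abs_sub_abs_eq_min (p q : ℝ) : |(|p| - |q|)| = min |p + q| |p - q| := by
  refine le_antisymm (le_min ?_ (abs_abs_sub_abs_le_abs_sub p q)) ?_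
  · simpa using abs_abs_sub_abs_le_abs_sub p (-q)
  · rcases abs_cases p with ⟨h1, _⟩ | ⟨h1, _⟩ <;> rcases abs_cases q with ⟨h2, _⟩ | ⟨h2, _⟩ <;>
      rw [h1, h2]
    · exact min_le_right _ _
    · rw [sub_neg_eq_add]
      exact min_le_left _ _
    · rw [← abs_neg (-p - q), neg_sub, sub_neg_eq_add, add_comm q]
      exact min_le_left _ _
    · rw [← abs_neg (-p - -q), neg_sub, neg_sub_neg]
      exact min_le_right _ _

lemma min_abs_eq (a b : ℝ) : min |a| |b| = |a| + |b| - (|a + b| + |a - b|) / 2 := by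
  have h1 := max_add_min |a| |b|
  have h2 : max |a| |b| = (|a + b| + |a - b|) / 2 := by
    rcases abs_cases a with ⟨h1, _⟩ | ⟨h1, _⟩ <;> rcases abs_cases b with ⟨h2, _⟩ | ⟨h2, _⟩ <;>
    rcases abs_cases (a + b) with ⟨h3, _⟩ | ⟨h3, _⟩ <;>
    rcases abs_cases (a - b) with ⟨h4, _⟩ | ⟨h4, _⟩ <;>
    rw [h1, h2, h3, h4] <;>
    first
      | (rw [max_eq_left (by linarith)]; linarith)
      | (rw [max_eq_right (by linarith)]; linarith)
  linarith

lemma absDiffL1_one_eq_sum_min (A : Matrix (Fin m) (Fin n) ℝ) (x y : EuclideanSpace ℝ (Fin n)) :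
    absDiffL1 1 A x y
      = ∑ i, min |A.mulVec (x + y).ofLp i| |A.mulVec (x - y).ofLp i| := by
  refine Finset.sum_congr rfl fun i _ => ?_
  rw [pow_one, pow_one, abs_abs_sub_abs_eq_min, WithLp.ofLp_add, WithLp.ofLp_sub,
    Matrix.mulVec_add, Matrix.mulVec_sub, Pi.add_apply, Pi.sub_apply]

lemma mean_sum_min_eq (A : Matrix (Fin m) (Fin n) ℝ) (u v : EuclideanSpace ℝ (Fin n)) :
    1 / (m : ℝ) * ∑ i, min |A.mulVec u.ofLp i| |A.mulVec v.ofLp i|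
      = meanAbsMulVec A u + meanAbsMulVec A v
        - (meanAbsMulVec A (u + v) + meanAbsMulVec A (u - v)) / 2 := by
  simp only [meanAbsMulVec_apply, min_abs_eq, WithLp.ofLp_add, WithLp.ofLp_sub, Matrix.mulVec_add,
    Matrix.mulVec_sub, Pi.add_apply, Pi.sub_apply, Finset.sum_sub_distrib, Finset.sum_add_distrib,
    ← Finset.sum_div]
  ring

lemma norm_add_add_norm_sub_le {F : Type*} [NormedAddCommGroup F] [InnerProductSpace ℝ F]
    {u v : F} (h : ‖u‖ = ‖v‖) : ‖u + v‖ + ‖u - v‖ ≤ 2 * √2 * ‖v‖ := by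
  have hp := parallelogram_law_with_norm ℝ u v
  rw [h] at hp
  refine abs_le_of_sq_le_sq' ?_ (by positivity) |>.2
  have h2 : √2 ^ 2 = (2 : ℝ) := Real.sq_sqrt (by norm_num)
  nlinarith [sq_nonneg (‖u + v‖ - ‖u - v‖)]

/-- Lower bound on the mean of `min (|⟨aᵢ, u⟩|, |⟨aᵢ, v⟩|)` from an `ℓ₁`-isometry property. -/
lemma le_mean_sum_min (A : Matrix (Fin m) (Fin n) ℝ) {η μ : ℝ} (hη : 0 ≤ η) (hμ : 0 ≤ μ)
    (hA : ∀ w, (1 - η) * μ * ‖w‖ ≤ meanAbsMulVec A w ∧ meanAbsMulVec A w ≤ (1 + η) * μ * ‖w‖)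
    {u v : EuclideanSpace ℝ (Fin n)} (huv : ‖v‖ ≤ ‖u‖) :
    μ * (2 - √2 - 4 * η) * ‖v‖
      ≤ 1 / (m : ℝ) * ∑ i, min |A.mulVec u.ofLp i| |A.mulVec v.ofLp i| := by
  rcases eq_or_ne v 0 with rfl | hv
  · rw [norm_zero, mul_zero]
    positivity
  have hvpos : 0 < ‖v‖ := norm_pos_iff.mpr hv
  have hupos : 0 < ‖u‖ := hvpos.trans_le huv
  have hr0 : 0 ≤ ‖v‖ / ‖u‖ := by positivity
  have hr1 : ‖v‖ / ‖u‖ ≤ 1 := div_le_one_of_le₀ huv hupos.le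
  set u' := (‖v‖ / ‖u‖) • u with hu'
  have hnorm : ‖u'‖ = ‖v‖ := by
    rw [hu', norm_smul, Real.norm_of_nonneg hr0, div_mul_cancel₀ _ hupos.ne']
  have hmono : 1 / (m : ℝ) * ∑ i, min |A.mulVec u'.ofLp i| |A.mulVec v.ofLp i|
      ≤ 1 / (m : ℝ) * ∑ i, min |A.mulVec u.ofLp i| |A.mulVec v.ofLp i| := by
    refine mul_le_mul_of_nonneg_left (Finset.sum_le_sum fun i _ => min_le_min_right _ ?_)
      (by positivity)
    rw [hu', WithLp.ofLp_smul, Matrix.mulVec_smul, Pi.smul_apply, smul_eq_mul, abs_mul,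
      abs_of_nonneg hr0]
    exact mul_le_of_le_one_left (abs_nonneg _) hr1
  refine le_trans ?_ hmono
  rw [mean_sum_min_eq]
  have h1 := (hA u').1
  have h2 := (hA v).1
  have h3 := (hA (u' + v)).2
  have h4 := (hA (u' - v)).2
  have h5 := norm_add_add_norm_sub_le hnorm
  rw [hnorm] at h1
  have h6 : (1 + η) * μ * (‖u' + v‖ + ‖u' - v‖) ≤ (1 + η) * μ * (2 * √2 * ‖v‖) := by gcongr
  have h7 : √2 ≤ 2 := by rw [Real.sqrt_le_left (by norm_num)]; norm_num
  -- The total error is `(2 + √2) η`; this term rounds it up to `4 η`.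
  have h8 : 0 ≤ (2 - √2) * (η * (μ * ‖v‖)) :=
    mul_nonneg (by linarith) (by positivity)
  nlinarith

lemma growth_of_meanAbsMulVec_bounds (A : Matrix (Fin m) (Fin n) ℝ) {η μ : ℝ} (hη : 0 ≤ η)
    (hμ : 0 ≤ μ)
    (hA : ∀ w, (1 - η) * μ * ‖w‖ ≤ meanAbsMulVec A w ∧ meanAbsMulVec A w ≤ (1 + η) * μ * ‖w‖)
    (x y : EuclideanSpace ℝ (Fin n)) :
    μ * (2 - √2 - 4 * η) * phiOne x y ≤ 1 / (m : ℝ) * absDiffL1 1 A x y ∧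
      1 / (m : ℝ) * absDiffL1 1 A x y ≤ μ * (1 + η) * phiOne x y := by
  rw [absDiffL1_one_eq_sum_min, phiOne]
  have hle : ∀ (f g : Fin m → ℝ) (w : EuclideanSpace ℝ (Fin n)),
      (∀ i, min (f i) (g i) ≤ |A.mulVec w.ofLp i|) →
      1 / (m : ℝ) * ∑ i, min (f i) (g i) ≤ μ * (1 + η) * ‖w‖ := fun f g w h =>
    calc _ ≤ meanAbsMulVec A w := by
          rw [meanAbsMulVec_apply]
          gcongr with i
          exact h i
      _ ≤ _ := by rw [mul_comm μ]; exact (hA w).2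
  rcases le_total ‖x + y‖ ‖x - y‖ with h | h
  · rw [min_eq_left h]
    refine ⟨?_, hle _ _ _ fun i => min_le_left _ _⟩
    simp_rw [min_comm |A.mulVec (x + y).ofLp _|]
    exact le_mean_sum_min A hη hμ hA h
  · rw [min_eq_right h]
    exact ⟨le_mean_sum_min A hη hμ hA h, hle _ _ _ fun i => min_le_right _ _⟩

end MeanAbs

/-! ### Union bound and choice of constants. -/

section MainBounds

variable {Ω : Type*} [MeasurableSpace Ω] {P : Measure Ω} [IsProbabilityMeasure P] {m n : ℕ}
  {A : Ω → Matrix (Fin m) (Fin n) ℝ}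

/-- The `ℓ₁`-isometry property of Gaussian matrices. -/
lemma IsStdGaussianMatrix.measureReal_bounds_ge (hA : IsStdGaussianMatrix P A) (hm : 0 < m)
    {δ : ℝ} (hδ : 0 < δ) (hδ2 : δ ≤ 1 / 2) :
    1 - (3 / δ) ^ n * (2 * Real.exp (-(m * δ ^ 2 / (2 * Real.pi)))) ≤
      P.real {ω | ∀ w, (1 - 4 * δ) * √(2 / Real.pi) * ‖w‖ ≤ meanAbsMulVec (A ω) w ∧
        meanAbsMulVec (A ω) w ≤ (1 + 4 * δ) * √(2 / Real.pi) * ‖w‖} := by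
  set μ := √(2 / Real.pi) with hμ
  have hμpos : 0 < μ := by positivity
  have hm' : (0 : ℝ) < m := by exact_mod_cast hm
  obtain ⟨T, hT, hnet, hcard⟩ := exists_finset_net_sphere (E := EuclideanSpace ℝ (Fin n)) hδ
    (by linarith)
  rw [finrank_euclideanSpace_fin] at hcard
  let bad (z : EuclideanSpace ℝ (Fin n)) : Set Ω :=
    {ω | m * (δ * μ) ≤ |∑ i, |(A ω).mulVec z.ofLp i| - m * μ|}
  set good := {ω | ∀ w, (1 - 4 * δ) * μ * ‖w‖ ≤ meanAbsMulVec (A ω) w ∧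
    meanAbsMulVec (A ω) w ≤ (1 + 4 * δ) * μ * ‖w‖}
  -- Covering the whole space needs only subadditivity, so `good` need not be shown measurable.
  have hcover : Set.univ ⊆ good ∪ ⋃ z ∈ T, bad z := by
    intro ω _
    by_cases h : ω ∈ ⋃ z ∈ T, bad z
    · exact Or.inr h
    refine Or.inl fun w => (meanAbsMulVec (A ω)).bounds_of_net (continuous_meanAbsMulVec _) hδ hδ2
      hμpos hnet (fun z hz => ?_) w
    simp only [bad, Set.mem_iUnion, Set.mem_ofPred_eq, exists_prop, not_exists, not_and,
      not_le] at h
    have h1 := h z hz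
    have h2 : meanAbsMulVec (A ω) z - μ = (∑ i, |(A ω).mulVec z.ofLp i| - m * μ) / m := by
      rw [meanAbsMulVec_apply]
      field_simp
    rw [h2, abs_div, abs_of_pos hm', div_le_iff₀ hm', mul_comm (δ * μ)]
    exact h1.le
  have hbad : ∀ z ∈ T, P.real (bad z) ≤ 2 * Real.exp (-(m * δ ^ 2 / (2 * Real.pi))) :=
    fun z hz => by
      refine (hA.measureReal_abs_sum_sub_ge (hT z hz) (s := δ * μ) (by positivity)).trans_eq ?_
      rw [mul_pow, hμ, Real.sq_sqrt (by positivity)]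
      congr 3
      field_simp
      ring
  have h1 : (1 : ℝ) ≤ P.real good + P.real (⋃ z ∈ T, bad z) := by
    rw [← probReal_univ (μ := P)]
    exact (measureReal_mono hcover).trans (measureReal_union_le _ _)
  have h2 : P.real (⋃ z ∈ T, bad z) ≤ (3 / δ) ^ n *
      (2 * Real.exp (-(m * δ ^ 2 / (2 * Real.pi)))) :=
    calc _ ≤ ∑ z ∈ T, P.real (bad z) := measureReal_biUnion_finset_le _ _
      _ ≤ T.card * (2 * Real.exp (-(m * δ ^ 2 / (2 * Real.pi)))) := by
        rw [← nsmul_eq_mul]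
        exact Finset.sum_le_card_nsmul _ _ _ hbad
      _ ≤ _ := by gcongr
  linarith

/-- Arithmetic behind the union bound over a net of size `(48/ε)^n`. -/
lemma net_union_bound_le {ε : ℝ} (hε : 0 < ε) (hε2 : ε < 1 / 2)
    (hmn : 28672 * (n : ℝ) * (ε ^ 4)⁻¹ * Real.log (1 / ε) < m) :
    (3 / (ε / 16)) ^ n * (2 * Real.exp (-(m * (ε / 16) ^ 2 / (2 * Real.pi))))
      ≤ 2 * Real.exp (-(1 / 4096 * ε ^ 4 * m)) := by
  -- As `48 ≤ 2 ^ 6 ≤ ε⁻⁶`, the net has at most `ε ^ (-7n)` points; `28672 = 7 * 4096` makes this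
  -- cost at most half of the tail exponent `m ε⁴ / 2048`.
  have hbase : 3 / (ε / 16) ≤ Real.exp (7 * Real.log (1 / ε)) := by
    have h1 : Real.exp (7 * Real.log (1 / ε)) = (1 / ε) ^ 7 := by
      rw [← Real.exp_log (show 0 < 1 / ε by positivity), ← Real.exp_nat_mul, Real.log_exp]
      norm_num
    have h2 : 2 ≤ 1 / ε := by rw [le_div_iff₀ hε]; linarith
    have h3 : (2 : ℝ) ^ 6 ≤ (1 / ε) ^ 6 := by gcongr
    calc 3 / (ε / 16) = 48 * (1 / ε) := by field_simp; norm_num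
      _ ≤ (1 / ε) ^ 6 * (1 / ε) := by gcongr; linarith
      _ = _ := by rw [h1]; ring
  have hpow : (3 / (ε / 16)) ^ n ≤ Real.exp (n * (7 * Real.log (1 / ε))) := by
    rw [Real.exp_nat_mul]
    gcongr
  have hlog : n * (7 * Real.log (1 / ε)) ≤ m * ε ^ 4 / 4096 := by
    have h : 28672 * (n : ℝ) * (ε ^ 4)⁻¹ * Real.log (1 / ε) * ε ^ 4 ≤ m * ε ^ 4 := by gcongr
    have : 28672 * (n : ℝ) * (ε ^ 4)⁻¹ * Real.log (1 / ε) * ε ^ 4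
        = 4096 * (n * (7 * Real.log (1 / ε))) := by
      field_simp
      ring
    linarith
  have htail : m * ε ^ 4 / 2048 ≤ m * (ε / 16) ^ 2 / (2 * Real.pi) := by
    rw [le_div_iff₀ (by positivity)]
    have h4 : ε ^ 4 ≤ ε ^ 2 := pow_le_pow_of_le_one hε.le (by linarith) (by norm_num)
    calc m * ε ^ 4 / 2048 * (2 * Real.pi) ≤ m * ε ^ 2 / 2048 * (2 * 4) := by
          gcongr
          exact Real.pi_le_four
      _ = _ := by ring
  calc _ ≤ Real.exp (n * (7 * Real.log (1 / ε))) *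
        (2 * Real.exp (-(m * (ε / 16) ^ 2 / (2 * Real.pi)))) := by gcongr
    _ = 2 * Real.exp (n * (7 * Real.log (1 / ε)) - m * (ε / 16) ^ 2 / (2 * Real.pi)) := by
        rw [sub_eq_add_neg, Real.exp_add]
        ring
    _ ≤ _ := by
        gcongr
        linarith

lemma IsStdGaussianMatrix.measureReal_growth_ge (hA : IsStdGaussianMatrix P A) {ε : ℝ}
    (hε : 0 < ε) (hε2 : ε < 1 / 2)
    (hmn : 28672 * (n : ℝ) * (ε ^ 4)⁻¹ * Real.log (1 / ε) < m) :
    1 - 2 * Real.exp (-(1 / 4096 * ε ^ 4 * m)) ≤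
      P.real {ω | ∀ x y : EuclideanSpace ℝ (Fin n),
        √(2 / Real.pi) * (2 - √2 - ε) * phiOne x y ≤ 1 / (m : ℝ) * absDiffL1 1 (A ω) x y ∧
        1 / (m : ℝ) * absDiffL1 1 (A ω) x y ≤ √(2 / Real.pi) * (1 + ε) * phiOne x y} := by
  have hlog : 0 ≤ Real.log (1 / ε) := Real.log_nonneg (by rw [le_div_iff₀ hε]; linarith)
  have hm : 0 < m := by
    have : (0 : ℝ) < m := lt_of_le_of_lt (by positivity) hmn
    exact_mod_cast this
  -- With net radius `δ = ε / 16` the isometry error is `η = 4δ = ε / 4`, and the lower bound loses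
  -- `4η = ε`.
  refine (sub_le_sub_left (net_union_bound_le hε hε2 hmn) 1).trans
    ((hA.measureReal_bounds_ge hm (by positivity) (by linarith)).trans
      (measureReal_mono fun ω hω x y => ?_))
  have h := growth_of_meanAbsMulVec_bounds (A ω) (by positivity) (Real.sqrt_nonneg _) hω x y
  have hφ : 0 ≤ phiOne x y := le_min (norm_nonneg _) (norm_nonneg _)
  refine ⟨?_, h.2.trans ?_⟩
  · convert h.1 using 3
    ring
  · gcongr
    linarith

end MainBounds

theorem lemma4p7 :
    ∃ C₀ C₁ C₂ ε₀ D₀ D₁ D₂ ν₁ ν₂ : ℝ,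
      0 < C₀ ∧ 0 < C₁ ∧ 0 < C₂ ∧ 0 < ε₀ ∧ 0 < D₀ ∧ 0 < D₁ ∧ 0 < D₂ ∧
      ∀ (m n : ℕ) (Ω : Type*) [MeasurableSpace Ω] (P : Measure Ω) [IsProbabilityMeasure P]
        (A : Ω → Matrix (Fin m) (Fin n) ℝ), IsStdGaussianMatrix P A →
        -- the two-sided bound with explicit constants
        (∀ ε : ℝ, 0 < ε → ε < ε₀ →
          C₀ * (n : ℝ) * (ε ^ 4)⁻¹ * Real.log (1 / ε) < (m : ℝ) →
          1 - C₁ * Real.exp (-(C₂ * ε ^ 4 * (m : ℝ))) ≤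
            P.real {ω | ∀ x y : EuclideanSpace ℝ (Fin n),
              √(2 / Real.pi) * (2 - √2 - ε) * phiOne x y
                  ≤ 1 / (m : ℝ) * absDiffL1 1 (A ω) x y ∧
              1 / (m : ℝ) * absDiffL1 1 (A ω) x y
                  ≤ √(2 / Real.pi) * (1 + ε) * phiOne x y}) ∧
        -- consequently, the 1-Absolute Growth Property with high probability
        (D₀ * (n : ℝ) < (m : ℝ) →
          1 - D₁ * Real.exp (-(D₂ * (m : ℝ))) ≤
            P.real {ω | AbsoluteGrowthProperty 1 (A ω) phiOne ν₁ ν₂}) := by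
  -- The second claim is the case `ε = 1/20`: `ν₂ < 2 ν₁` amounts to `3ε < 3 - 2√2 ≈ 0.17`.
  have hlog : 0 < Real.log (1 / (1 / 20 : ℝ)) := Real.log_pos (by norm_num)
  refine ⟨28672, 2, 1 / 4096, 1 / 2, 28672 * ((1 / 20 : ℝ) ^ 4)⁻¹ * Real.log (1 / (1 / 20)), 2,
    1 / 4096 * (1 / 20) ^ 4, √(2 / Real.pi) * (2 - √2 - 1 / 20), √(2 / Real.pi) * (1 + 1 / 20),
    by norm_num, by norm_num, by norm_num, by norm_num, by positivity, by norm_num, by norm_num,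
    fun m n Ω _ P _ A hA => ⟨fun ε hε hε2 hmn => hA.measureReal_growth_ge hε hε2 hmn,
      fun hmn => ?_⟩⟩
  refine (hA.measureReal_growth_ge (ε := 1 / 20) (by norm_num) (by norm_num)
    (lt_of_eq_of_lt (by ring) hmn)).trans (measureReal_mono fun ω hω => ?_)
  have hμ : 0 < √(2 / Real.pi) := by positivity
  have h2lo : 1.4 < √2 := Real.lt_sqrt_of_sq_lt (by norm_num)
  have h2hi : √2 < 1.42 := by rw [Real.sqrt_lt' (by norm_num)]; norm_num
  exact
    { pos := mul_pos hμ (by linarith)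
      lt := by gcongr; linarith
      lt_two_mul := by
        rw [mul_left_comm]
        gcongr
        linarith
      nonneg := fun x y => le_min (norm_nonneg _) (norm_nonneg _)
      growth := hω }
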